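/- Let $\Omega>0$ and $C=\frac{(1-\Omega)^2}{4\Omega}$. For $\alpha\in(0,1)$ and $m,n,k,l\in\mathbb N$ with $n-m=k-l=:h$ put $$\Gamma^\alpha_{m,n;k,l}=\Big(\frac{\sqrt{1-\alpha}}{1+C\alpha}\Big)^{m+l+h}(1-\alpha)^{-h/2}\sum_{u=\max(0,-h)}^{\min(m,l)}\frac{\sqrt{m!\,(m+h)!\,l!\,(l+h)!}}{(m-u)!\,(l-u)!\,(h+u)!\,u!}\Big(\frac{1-\Omega^2}{4\Omega}\,\frac{\alpha}{\sqrt{1-\alpha}}\Big)^{m+l-2u},$$ and $\Gamma^\alpha_{m,n;k,l}=0$ if $n-m\neq k-l$. For two-dimensional indices $m=(m_1,m_2)$, $n,k,l\in\mathbb N^2$, for $\theta>0$, $\mu\in\mathbb R$, $M>1$ and an integer $i\ge 1$, the matrix-basis $\phi^4_4$ propagator in the slice $i$ is $$G^i_{m,n;k,l}=\int_{M^{-i}}^{M^{-i+1}}d\alpha\,\frac{(1-\alpha)^{\mu^2\theta/(8\Omega)}}{(1+C\alpha)^2}\prod_{r=1}^{2}\Gamma^\alpha_{m_r,n_r;k_r,l_r}\,(1-\alpha)^{(n_r-m_r)/2}.$$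 Write $p_r=|l_r-m_r|$ and $\kappa_r=\max(m_r,n_r,k_r,l_r)$ (so that $p_r=l_r-m_r$ and $\kappa_r=k_r$ when $n_r-m_r=k_r-l_r\ge 0$ and $l_r\ge m_r$). Then there is a constant $c>0$ depending only on $\Omega$ and, for every $M>1$, a constant $K>0$ depending only on $\Omega$ and on the slicing ratio $M$ such that, for all $\theta>0$, $\mu\in\mathbb R$, $i\ge1$ and all $m,n,k,l\in\mathbb N^2$, the integral defining $G^i_{m,n;k,l}$ converges absolutely and $$|G^i_{m,n;k,l}|\le K\,M^{-i}\,\prod_{r=1}^{2}\min\big(1,(M^{-i}\kappa_r)^{p_r}\big)\;\exp\Big(-c\sum_{r=1}^2\big(M^{-i}\kappa_r+p_r\big)\Big),$$ where $0^0=1$. -/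

import Mathlib

noncomputable section

namespace MoyalPhi4

/-- The constant `C = (1 - Ω)² / (4 Ω)`. -/
def constC (Ω : ℝ) : ℝ := (1 - Ω) ^ 2 / (4 * Ω)

/-- The combinatorial coefficient `𝒜(m,l,h,u)` for `n = m + h`, `k = l + h`:
`√(m! (m+h)! l! (l+h)!) / ((m-u)! (l-u)! (h+u)! u!)`.
It is only used for `max(0,-h) ≤ u ≤ min(m,l)`, where no natural subtraction truncates
(`h + u = n + u - m`). -/
def coeffA (m n k l u : ℕ) : ℝ :=
  Real.sqrt ((m.factorial : ℝ) * n.factorial * l.factorial * k.factorial) /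
    ((m - u).factorial * (l - u).factorial * (n + u - m).factorial * u.factorial)

/-- The kernel `Γ^α_{m,n;k,l}` in the matrix basis of one Moyal plane, with parameter `B`.
The matrix element vanishes unless `n - m = k - l`; in that case, with `h = n - m`, it is
`(√(1-α) / (1 + Cα))^{m+l+h} (1-α)^{-Bh/(2Ω)}
  ∑_{u = max(0,-h)}^{min(m,l)} 𝒜(m,l,h,u) (Cα(1+Ω) / (√(1-α) (1-Ω)))^{m+l-2u}`.
Here `C(1+Ω)/(1-Ω)` is written `(1-Ω²)/(4Ω)`, which also makes sense at `Ω = 1`;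
moreover `m + l + h = n + l`, and `max(0,-h)` is the truncated difference `m - n`. -/
def gammaAlpha (Ω B α : ℝ) (m n k l : ℕ) : ℝ :=
  if m + k = n + l then
    (Real.sqrt (1 - α) / (1 + constC Ω * α)) ^ (n + l) *
      (1 - α) ^ (-(B * ((n : ℝ) - m)) / (2 * Ω)) *
      ∑ u ∈ Finset.Icc (m - n) (min m l),
        coeffA m n k l u *
          (α * ((1 - Ω ^ 2) / (4 * Ω)) / Real.sqrt (1 - α)) ^ (m + l - 2 * u)
  else 0

/-- Indices of the four-dimensional `φ⁴` model: one natural number for each of the two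
Moyal planes. -/
abbrev Index : Type := Fin 2 → ℕ

/-- `G^{α,φ⁴}_{m,n;k,l} = Γ^α_{m,n;k,l} (1-α)^{h/2}`, with `h = n - m` and `Γ^α` taken at `B = Ω`;
for two-dimensional indices this is the product over the two planes. -/
def phi4Alpha (Ω α : ℝ) (m n k l : Index) : ℝ :=
  ∏ r : Fin 2, gammaAlpha Ω Ω α (m r) (n r) (k r) (l r) *
    (1 - α) ^ (((n r : ℝ) - m r) / 2)

/-- The integrand of the `φ⁴₄` propagator:
`(1-α)^{μ²θ/(8Ω)} / (1 + Cα)² * G^{α,φ⁴}_{m,n;k,l}`. -/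
def phi4Integrand (Ω θ μ : ℝ) (m n k l : Index) (α : ℝ) : ℝ :=
  (1 - α) ^ (μ ^ 2 * θ / (8 * Ω)) / (1 + constC Ω * α) ^ 2 * phi4Alpha Ω α m n k l

/-- The `φ⁴₄` propagator in the slice `i`: the integral over `M^{-i} ≤ α ≤ M^{-i+1}`. -/
def phi4Slice (Ω θ μ M : ℝ) (i : ℕ) (m n k l : Index) : ℝ :=
  ∫ α in (M ^ (-(i : ℤ)))..(M ^ (-(i : ℤ) + 1)), phi4Integrand Ω θ μ m n k l α

/-- The largest of the four indices, in each plane. It is `k` when `n - m = k - l`, `m ≤ n`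
and `m ≤ l`. -/
def maxIndex (m n k l : Index) (r : Fin 2) : ℕ := max (max (m r) (n r)) (max (k r) (l r))

/-- `p = |l - m|`, in each plane. -/
def shift (m l : Index) (r : Fin 2) : ℕ := ((l r : ℤ) - (m r : ℤ)).natAbs

end MoyalPhi4

end

namespace MoyalPhi4

/-! In each plane the coefficient is a geometric mean of products of binomial coefficients, so
Cauchy–Schwarz and the binomial theorem bound the sum over `u`. Weighting the two sides unequally
inserts a factor `s ^ p` for free (`tilted_sum_coeffA_le`): `s ^ p` times the kernel is at most
`((√(1-α) + dαs)/(1+Cα)) ^ (n+l)`, with `d = |1-Ω²|/(4Ω)`. Since `d < C + 1/2`, a fixed `s > 1`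
gives exponential decay (`exists_decay`). For `x = M^{-i}κ < 1`, taking `s` of order `1/x` keeps the
right side bounded and gives `x ^ p` (`abs_gammaAlpha_le_pow`). The slice length supplies `M^{-i}`.
-/

/-! ### Binomial bounds for the sum over `u`. -/

lemma sum_choose_mul_choose_le {m n : ℕ} {a b : ℝ} (ha : 0 ≤ a) (hb : 0 ≤ b) (S : Finset ℕ)
    (hS : ∀ u ∈ S, u ≤ m ∧ m ≤ n + u) :
    ∑ u ∈ S, ((m.choose u : ℝ) * a ^ u * b ^ (m - u)) *
        ((n.choose (n + u - m) : ℝ) * a ^ (n + u - m) * b ^ (m - u)) ≤ (a + b) ^ (m + n) := by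
  have binom (N : ℕ) : ∑ u ∈ Finset.range (N + 1), (N.choose u : ℝ) * a ^ u * b ^ (N - u) =
      (a + b) ^ N := by
    rw [add_pow]
    exact Finset.sum_congr rfl fun u _ => by ring
  have nonneg (N u v : ℕ) : 0 ≤ (N.choose u : ℝ) * a ^ u * b ^ v := by positivity
  -- A single term of a binomial expansion is at most the whole; only the other factor is summed.
  have h2 : ∀ u ∈ S, (n.choose (n + u - m) : ℝ) * a ^ (n + u - m) * b ^ (m - u) ≤
      (a + b) ^ n := by
    intro u hu
    obtain ⟨h1, h2⟩ := hS u hu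
    have hmem : n + u - m ∈ Finset.range (n + 1) := by
      rw [Finset.mem_range]; omega
    have := Finset.single_le_sum
      (f := fun v => (n.choose v : ℝ) * a ^ v * b ^ (n - v)) (fun v _ => nonneg n v _) hmem
    rw [binom] at this
    have e : n - (n + u - m) = m - u := by omega
    simpa only [e] using this
  have h1 : ∑ u ∈ S, (m.choose u : ℝ) * a ^ u * b ^ (m - u) ≤ (a + b) ^ m := by
    rw [← binom]
    refine Finset.sum_le_sum_of_subset_of_nonneg (fun u hu => ?_) (fun u _ _ => nonneg m u _)
    have := (hS u hu).1
    rw [Finset.mem_range]; omega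
  calc _ ≤ ∑ u ∈ S, ((m.choose u : ℝ) * a ^ u * b ^ (m - u)) * (a + b) ^ n :=
        Finset.sum_le_sum fun u hu => mul_le_mul_of_nonneg_left (h2 u hu) (nonneg m u _)
    _ ≤ _ := by
        rw [← Finset.sum_mul, pow_add]
        exact mul_le_mul_of_nonneg_right h1 (by positivity)

/-- The coefficient is the geometric mean of binomial coefficients. -/
lemma coeffA_eq_sqrt_choose {m n k l u : ℕ} (h : m + k = n + l) (hm : u ≤ m) (hl : u ≤ l)
    (hn : m ≤ n + u) :
    coeffA m n k l u =
      √(((m.choose u : ℝ) * n.choose (n + u - m)) * ((l.choose u : ℝ) * k.choose (k + u - l))) := by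
  have e : k + u - l = n + u - m := by omega
  rw [Nat.cast_choose ℝ hm, Nat.cast_choose ℝ hl,
    Nat.cast_choose ℝ (show n + u - m ≤ n by omega),
    Nat.cast_choose ℝ (show k + u - l ≤ k by omega), e,
    show n - (n + u - m) = m - u by omega, show k - (n + u - m) = l - u by omega, coeffA]
  symm
  rw [Real.sqrt_eq_iff_mul_self_eq (by positivity) (by positivity), div_mul_div_comm (√_),
    Real.mul_self_sqrt (by positivity)]
  field_simp

/-- Cauchy–Schwarz separates `(m, n)` from `(l, k)`. Keeping `b` and `b'` distinct leaves room for
the tilt. -/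
lemma sum_coeffA_le {m n k l : ℕ} (h : m + k = n + l) {a b b' : ℝ} (ha : 0 ≤ a) (hb : 0 ≤ b)
    (hb' : 0 ≤ b') :
    ∑ u ∈ Finset.Icc (m - n) (min m l),
        coeffA m n k l u * (a ^ (n + u - m) * a ^ u * b ^ (m - u) * b' ^ (l - u)) ≤
      √((a + b) ^ (m + n)) * √((a + b') ^ (l + k)) := by
  have hS : ∀ u ∈ Finset.Icc (m - n) (min m l), u ≤ m ∧ m ≤ n + u ∧ u ≤ l ∧ l ≤ k + u := by
    intro u hu
    rw [Finset.mem_Icc] at hu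
    omega
  set F : ℕ → ℝ := fun u => ((m.choose u : ℝ) * a ^ u * b ^ (m - u)) *
        ((n.choose (n + u - m) : ℝ) * a ^ (n + u - m) * b ^ (m - u)) with hF
  set G : ℕ → ℝ := fun u => ((l.choose u : ℝ) * a ^ u * b' ^ (l - u)) *
        ((k.choose (k + u - l) : ℝ) * a ^ (k + u - l) * b' ^ (l - u)) with hG
  have hF0 (u : ℕ) : 0 ≤ F u := by positivity
  have hG0 (u : ℕ) : 0 ≤ G u := by positivity
  have hterm : ∀ u ∈ Finset.Icc (m - n) (min m l),
      coeffA m n k l u * (a ^ (n + u - m) * a ^ u * b ^ (m - u) * b' ^ (l - u)) =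
        √(F u) * √(G u) := by
    intro u hu
    obtain ⟨h1, h2, h3, h4⟩ := hS u hu
    rw [coeffA_eq_sqrt_choose h h1 h3 h2, ← Real.sqrt_mul (hF0 u),
      show F u * G u = (((m.choose u : ℝ) * n.choose (n + u - m)) *
        ((l.choose u : ℝ) * k.choose (k + u - l))) *
        (a ^ (n + u - m) * a ^ u * b ^ (m - u) * b' ^ (l - u)) ^ 2 by
        simp only [hF, hG, show k + u - l = n + u - m by omega]; ring,
      Real.sqrt_mul' _ (sq_nonneg _), Real.sqrt_sq (by positivity)]
  rw [Finset.sum_congr rfl hterm]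
  refine (Real.sum_sqrt_mul_sqrt_le _ hF0 hG0).trans ?_
  refine mul_le_mul (Real.sqrt_le_sqrt ?_) (Real.sqrt_le_sqrt ?_) (by positivity) (by positivity)
  · exact sum_choose_mul_choose_le ha hb _ fun u hu => ⟨(hS u hu).1, (hS u hu).2.1⟩
  · exact sum_choose_mul_choose_le ha hb' _ fun u hu => ⟨(hS u hu).2.2.1, (hS u hu).2.2.2⟩

lemma coeffA_nonneg (m n k l u : ℕ) : 0 ≤ coeffA m n k l u := by
  unfold coeffA; positivity

/-- The exponentially tilted sum is controlled by the binomial theorem. -/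
lemma tilted_sum_coeffA_le {m n k l : ℕ} (h : m + k = n + l) {a b s : ℝ} (ha : 0 ≤ a)
    (hb : 0 ≤ b) (hs : 1 ≤ s) :
    (∑ u ∈ Finset.Icc (m - n) (min m l),
        coeffA m n k l u * (a ^ (n + u - m) * a ^ u * b ^ (m + l - 2 * u))) *
        s ^ ((l : ℤ) - (m : ℤ)).natAbs ≤ (a + b * s) ^ (n + l) := by
  have hs0 : 0 < s := by linarith
  have hbs : b / s ≤ b * s := by
    rw [div_le_iff₀ hs0]; nlinarith [mul_nonneg hb (show 0 ≤ s * s - 1 by nlinarith)]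
  have key (b₁ b₂ : ℝ) (h₁ : 0 ≤ b₁) (h₂ : 0 ≤ b₂) (h₁' : b₁ ≤ b * s) (h₂' : b₂ ≤ b * s) :
      √((a + b₁) ^ (m + n)) * √((a + b₂) ^ (l + k)) ≤ (a + b * s) ^ (n + l) := by
    rw [← Real.sqrt_mul (by positivity)]
    refine Real.sqrt_le_iff.2 ⟨by positivity, ?_⟩
    calc (a + b₁) ^ (m + n) * (a + b₂) ^ (l + k)
        ≤ (a + b * s) ^ (m + n) * (a + b * s) ^ (l + k) := by gcongr
      _ = ((a + b * s) ^ (n + l)) ^ 2 := by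
        rw [← pow_add, ← pow_mul]; congr 1; omega
  rw [Finset.sum_mul]
  -- The smaller of `m`, `l` receives `b / s`, the larger `b * s`; the powers of `s` then combine to
  -- `s ^ |l - m|` for every `u`.
  rcases le_total m l with hml | hml
  · refine le_trans (le_of_eq ?_) ((sum_coeffA_le h ha (show 0 ≤ b / s by positivity)
      (show 0 ≤ b * s by positivity)).trans
      (key _ _ (by positivity) (by positivity) hbs le_rfl))
    refine Finset.sum_congr rfl fun u hu => ?_
    rw [Finset.mem_Icc] at hu
    rw [show ((l : ℤ) - (m : ℤ)).natAbs = l - m by omega,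
      show m + l - 2 * u = (m - u) + (l - u) by omega, div_pow, mul_pow,
      show s ^ (l - u) = s ^ (m - u) * s ^ (l - m) by rw [← pow_add]; congr 1; omega, pow_add]
    field_simp
  · refine le_trans (le_of_eq ?_) ((sum_coeffA_le h ha (show 0 ≤ b * s by positivity)
      (show 0 ≤ b / s by positivity)).trans
      (key _ _ (by positivity) (by positivity) le_rfl hbs))
    refine Finset.sum_congr rfl fun u hu => ?_
    rw [Finset.mem_Icc] at hu
    rw [show ((l : ℤ) - (m : ℤ)).natAbs = m - l by omega,
      show m + l - 2 * u = (m - u) + (l - u) by omega, div_pow, mul_pow,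
      show s ^ (m - u) = s ^ (l - u) * s ^ (m - l) by rw [← pow_add]; congr 1; omega, pow_add]
    field_simp

/-! ### Pointwise bounds in one plane. -/

lemma constC_nonneg {Ω : ℝ} (hΩ : 0 < Ω) : 0 ≤ constC Ω := by
  unfold constC; positivity

/-- One factor of `phi4Alpha`, with the powers of `1 - α` collected. -/
lemma gammaAlpha_mul_rpow {Ω α : ℝ} (hΩ : 0 < Ω) (hα : α < 1) {m n k l : ℕ} (h : m + k = n + l) :
    gammaAlpha Ω Ω α m n k l * (1 - α) ^ (((n : ℝ) - m) / 2) =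
      (∑ u ∈ Finset.Icc (m - n) (min m l), coeffA m n k l u *
        (√(1 - α) ^ (n + u - m) * √(1 - α) ^ u * (α * ((1 - Ω ^ 2) / (4 * Ω))) ^ (m + l - 2 * u)))
        / (1 + constC Ω * α) ^ (n + l) := by
  have h1 : 0 < 1 - α := by linarith
  have ha : 0 < √(1 - α) := Real.sqrt_pos.2 h1
  have hexp : (1 - α) ^ (-(Ω * ((n : ℝ) - m)) / (2 * Ω)) * (1 - α) ^ (((n : ℝ) - m) / 2) = 1 := by
    rw [← Real.rpow_add h1, show -(Ω * ((n : ℝ) - m)) / (2 * Ω) + ((n : ℝ) - m) / 2 = 0 by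
      field_simp; ring, Real.rpow_zero]
  rw [gammaAlpha, if_pos h]
  set X := ∑ u ∈ Finset.Icc (m - n) (min m l), coeffA m n k l u *
    (α * ((1 - Ω ^ 2) / (4 * Ω)) / √(1 - α)) ^ (m + l - 2 * u) with hX
  calc _ = (√(1 - α) / (1 + constC Ω * α)) ^ (n + l) * X *
        ((1 - α) ^ (-(Ω * ((n : ℝ) - m)) / (2 * Ω)) * (1 - α) ^ (((n : ℝ) - m) / 2)) := by ring
    _ = _ := by
      rw [hexp, mul_one, div_pow, div_mul_eq_mul_div, hX, Finset.mul_sum]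
      congr 1
      refine Finset.sum_congr rfl fun u hu => ?_
      rw [Finset.mem_Icc] at hu
      rw [div_pow, ← pow_add,
        show n + l = (n + u - m + u) + (m + l - 2 * u) by omega, pow_add]
      field_simp

lemma abs_gammaAlpha_mul_pow_le {Ω α s : ℝ} (hΩ : 0 < Ω) (hα₀ : 0 ≤ α) (hα : α < 1) (hs : 1 ≤ s)
    {m n k l : ℕ} (h : m + k = n + l) :
    |gammaAlpha Ω Ω α m n k l * (1 - α) ^ (((n : ℝ) - m) / 2)| *
        s ^ ((l : ℤ) - (m : ℤ)).natAbs ≤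
      ((√(1 - α) + |(1 - Ω ^ 2) / (4 * Ω)| * α * s) / (1 + constC Ω * α)) ^ (n + l) := by
  have hC := constC_nonneg hΩ
  have hden : 0 < (1 + constC Ω * α) ^ (n + l) := by positivity
  have hs0 : 0 < s := by linarith
  rw [gammaAlpha_mul_rpow hΩ hα h, abs_div, abs_of_pos hden, div_pow, div_mul_eq_mul_div]
  gcongr
  refine le_trans ?_ (tilted_sum_coeffA_le h (Real.sqrt_nonneg _)
    (show 0 ≤ |(1 - Ω ^ 2) / (4 * Ω)| * α by positivity) hs)
  gcongr
  refine (Finset.abs_sum_le_sum_abs _ _).trans (le_of_eq (Finset.sum_congr rfl fun u _ => ?_))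
  rw [abs_mul, abs_of_nonneg (coeffA_nonneg _ _ _ _ _), abs_mul,
    abs_of_nonneg (show 0 ≤ √(1 - α) ^ (n + u - m) * √(1 - α) ^ u by positivity), abs_pow, abs_mul,
    abs_of_nonneg hα₀, mul_comm α]

/-- This is `|1 - Ω²| < 1 + Ω²`. The `1/2` matches the slope of `√(1 - α)` at `0`, so the gap yields
decay. -/
lemma abs_coupling_lt {Ω : ℝ} (hΩ : 0 < Ω) : |(1 - Ω ^ 2) / (4 * Ω)| < constC Ω + 1 / 2 := by
  have e : constC Ω + 1 / 2 = (1 + Ω ^ 2) / (4 * Ω) := by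
    unfold constC; field_simp; ring
  rw [e, abs_lt, ← neg_div]
  constructor <;> gcongr <;> nlinarith [sq_pos_of_pos hΩ]

/-- Exponential decay in the indices and in the shift, uniformly in `α`. -/
lemma exists_decay {Ω : ℝ} (hΩ : 0 < Ω) :
    ∃ c : ℝ, 0 < c ∧ ∀ α : ℝ, 0 ≤ α → α < 1 → ∀ m n k l : ℕ, m + k = n + l →
      |gammaAlpha Ω Ω α m n k l * (1 - α) ^ (((n : ℝ) - m) / 2)| ≤
        Real.exp (-c * (α * ((n + l : ℕ) : ℝ) + (((l : ℤ) - (m : ℤ)).natAbs : ℝ))) := by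
  set d := |(1 - Ω ^ 2) / (4 * Ω)| with hd
  have hd0 : 0 ≤ d := abs_nonneg _
  have hC := constC_nonneg hΩ
  have hlt : d < constC Ω + 1 / 2 := abs_coupling_lt hΩ
  set δ := constC Ω + 1 / 2 - d with hδ
  have hδ0 : 0 < δ := by linarith
  -- The tilt spends at most half of the gap `δ`; the other half gives the decay rate `c₁`.
  set s := 1 + δ / (2 * (d + 1)) with hs
  have hs1 : 1 < s := by
    have : 0 < δ / (2 * (d + 1)) := by positivity
    linarith
  have hds : d * s ≤ constC Ω + 1 / 2 - δ / 2 := by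
    have : d * (δ / (2 * (d + 1))) ≤ δ / 2 := by
      rw [← mul_div_assoc, div_le_div_iff₀ (by positivity) (by positivity)]
      nlinarith
    rw [hs]; linarith
  set c₁ := δ / 2 / (1 + constC Ω) with hc₁
  have hc₁0 : 0 < c₁ := by positivity
  have hlog : 0 < Real.log s := Real.log_pos hs1
  refine ⟨min c₁ (Real.log s), lt_min hc₁0 hlog, fun α hα₀ hα m n k l h => ?_⟩
  set c := min c₁ (Real.log s)
  set p := ((l : ℤ) - (m : ℤ)).natAbs
  have hden : 0 < 1 + constC Ω * α := by positivity
  have hsqrt : √(1 - α) ≤ 1 - α / 2 := by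
    rw [Real.sqrt_le_iff]; constructor <;> nlinarith [sq_nonneg α]
  have hbase : (√(1 - α) + d * α * s) / (1 + constC Ω * α) ≤ Real.exp (-(c₁ * α)) := by
    refine le_trans ?_ (Real.one_sub_le_exp_neg _)
    rw [div_le_iff₀ hden]
    have h1 : c₁ * (1 + constC Ω) = δ / 2 := by rw [hc₁]; field_simp
    have h2 : c₁ * α * (1 + constC Ω * α) ≤ δ / 2 * α := by
      rw [← h1]
      have : constC Ω * α ≤ constC Ω := by nlinarith
      have : c₁ * α * (1 + constC Ω * α) ≤ c₁ * α * (1 + constC Ω) := by gcongr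
      linarith
    nlinarith
  have hmain := abs_gammaAlpha_mul_pow_le hΩ hα₀ hα hs1.le h
  have hpow : ((√(1 - α) + d * α * s) / (1 + constC Ω * α)) ^ (n + l) ≤
      Real.exp (-(c₁ * α)) ^ (n + l) := by
    gcongr
  rw [← Real.exp_nat_mul] at hpow
  have hsp : Real.exp (Real.log s * p) = s ^ p := by
    rw [mul_comm, Real.exp_nat_mul, Real.exp_log (by linarith)]
  have h3 := hmain.trans hpow
  rw [← hsp, ← le_div_iff₀ (Real.exp_pos _), ← Real.exp_sub] at h3
  refine h3.trans (Real.exp_le_exp.2 ?_)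
  have hcc : c ≤ c₁ := min_le_left _ _
  have hcl : c ≤ Real.log s := min_le_right _ _
  have hN : 0 ≤ α * ((n + l : ℕ) : ℝ) := by positivity
  have hp : (0 : ℝ) ≤ p := Nat.cast_nonneg _
  have := mul_le_mul_of_nonneg_right hcc hN
  have := mul_le_mul_of_nonneg_right hcl hp
  linarith

/-- Power-law smallness in the shift when `ε N` is small. -/
lemma abs_gammaAlpha_le_pow {Ω α ε M x E : ℝ} (hΩ : 0 < Ω) (hα₀ : 0 ≤ α) (hα : α < 1)
    (hαM : α ≤ M * ε) (hx : 0 < x) (hx1 : x ≤ 1) (hE : 1 ≤ E) {m n k l : ℕ} (h : m + k = n + l)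
    (hN : ε * ((n + l : ℕ) : ℝ) ≤ 2 * x) (hM : 0 ≤ M) :
    |gammaAlpha Ω Ω α m n k l * (1 - α) ^ (((n : ℝ) - m) / 2)| ≤
      Real.exp (2 * |(1 - Ω ^ 2) / (4 * Ω)| * M * E) *
        (x / E) ^ ((l : ℤ) - (m : ℤ)).natAbs := by
  set d := |(1 - Ω ^ 2) / (4 * Ω)| with hd
  have hd0 : 0 ≤ d := abs_nonneg _
  have hC := constC_nonneg hΩ
  have hE0 : 0 < E := by linarith
  -- The tilt is `s = E / x`; as `α (n + l) ≤ 2 M x`, the factor `1 / x` cancels in the exponent.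
  have hs : 1 ≤ E / x := by rw [le_div_iff₀ hx]; linarith
  have hmain := abs_gammaAlpha_mul_pow_le hΩ hα₀ hα hs h
  have hbase : (√(1 - α) + d * α * (E / x)) / (1 + constC Ω * α) ≤
      Real.exp (d * α * (E / x)) := by
    have h1 : √(1 - α) ≤ 1 := Real.sqrt_le_one.2 (by linarith)
    have h2 : 1 ≤ 1 + constC Ω * α := by
      have : 0 ≤ constC Ω * α := by positivity
      linarith
    refine (div_le_self (by positivity) h2).trans ?_
    have := Real.add_one_le_exp (d * α * (E / x))
    linarith
  have hpow : ((√(1 - α) + d * α * (E / x)) / (1 + constC Ω * α)) ^ (n + l) ≤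
      Real.exp (d * α * (E / x)) ^ (n + l) := by
    gcongr
  rw [← Real.exp_nat_mul] at hpow
  have hexp : ((n + l : ℕ) : ℝ) * (d * α * (E / x)) ≤ 2 * d * M * E := by
    have h1 : α * ((n + l : ℕ) : ℝ) ≤ M * (2 * x) := by
      calc α * ((n + l : ℕ) : ℝ) ≤ M * ε * ((n + l : ℕ) : ℝ) := by gcongr
        _ = M * (ε * ((n + l : ℕ) : ℝ)) := by ring
        _ ≤ M * (2 * x) := by gcongr
    calc ((n + l : ℕ) : ℝ) * (d * α * (E / x)) = d * (E / x) * (α * ((n + l : ℕ) : ℝ)) := by ring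
      _ ≤ d * (E / x) * (M * (2 * x)) := by gcongr
      _ = 2 * d * M * E := by field_simp
  have h3 := hmain.trans (hpow.trans (Real.exp_le_exp.2 hexp))
  have hinv : (x / E) ^ ((l : ℤ) - (m : ℤ)).natAbs =
      ((E / x) ^ ((l : ℤ) - (m : ℤ)).natAbs)⁻¹ := by
    rw [← inv_pow, inv_div]
  rwa [hinv, ← div_eq_mul_inv, le_div_iff₀ (by positivity)]

/-- The bound on one factor of `phi4Alpha` in a slice. -/
lemma exists_slice_bound {Ω : ℝ} (hΩ : 0 < Ω) :
    ∃ c : ℝ, 0 < c ∧ ∀ M : ℝ, 1 < M → ∃ K : ℝ, 0 < K ∧ ∀ ε α : ℝ, 0 < ε → ε ≤ α → α ≤ M * ε →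
      α < 1 → ∀ m n k l : ℕ,
      |gammaAlpha Ω Ω α m n k l * (1 - α) ^ (((n : ℝ) - m) / 2)| ≤
        K * (min 1 ((ε * (max (max m n) (max k l) : ℕ)) ^ ((l : ℤ) - (m : ℤ)).natAbs) *
          Real.exp (-c * (ε * (max (max m n) (max k l) : ℕ) +
            (((l : ℤ) - (m : ℤ)).natAbs : ℝ)))) := by
  obtain ⟨c, hc, hdecay⟩ := exists_decay hΩ
  refine ⟨c, hc, fun M hM =>
    -- `E = exp c` produces `exp (-c p)`; the extra `+ c` pays for `exp (-c x)` when `x < 1`.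
    ⟨Real.exp (2 * |(1 - Ω ^ 2) / (4 * Ω)| * M * Real.exp c + c), Real.exp_pos _, ?_⟩⟩
  intro ε α hε hεα hαM hα m n k l
  by_cases h : m + k = n + l
  swap
  · rw [gammaAlpha, if_neg h, zero_mul, abs_zero]
    positivity
  set κ := max (max m n) (max k l) with hκ
  set p := ((l : ℤ) - (m : ℤ)).natAbs with hp
  have hα₀ : 0 ≤ α := hε.le.trans hεα
  have hκN : κ ≤ n + l := by omega
  have hNκ : n + l ≤ 2 * κ := by omega
  have hκN' : (κ : ℝ) ≤ ((n + l : ℕ) : ℝ) := by exact_mod_cast hκN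
  have hNκ' : ((n + l : ℕ) : ℝ) ≤ 2 * (κ : ℝ) := by exact_mod_cast hNκ
  set x := ε * (κ : ℝ) with hx
  have hx0 : 0 ≤ x := by positivity
  by_cases hcase : 0 < x ∧ x < 1
  · obtain ⟨hxpos, hx1⟩ := hcase
    have hb := abs_gammaAlpha_le_pow hΩ hα₀ hα hαM hxpos hx1.le (Real.one_le_exp hc.le) h
      (show ε * ((n + l : ℕ) : ℝ) ≤ 2 * x by
        rw [hx]; nlinarith [mul_le_mul_of_nonneg_left hNκ' hε.le]) (by linarith)
    refine hb.trans ?_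
    rw [min_eq_right (pow_le_one₀ hx0 hx1.le), div_pow, ← Real.exp_nat_mul,
      div_eq_mul_inv (x ^ _), ← Real.exp_neg, Real.exp_add]
    have h1 : Real.exp (-(p * c)) ≤ Real.exp c * Real.exp (-c * (x + p)) := by
      rw [← Real.exp_add]
      refine Real.exp_le_exp.2 ?_
      nlinarith
    calc _ = Real.exp (2 * |(1 - Ω ^ 2) / (4 * Ω)| * M * Real.exp c) * x ^ p *
          Real.exp (-(p * c)) := by ring
      _ ≤ Real.exp (2 * |(1 - Ω ^ 2) / (4 * Ω)| * M * Real.exp c) * x ^ p *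
          (Real.exp c * Real.exp (-c * (x + p))) := by gcongr
      _ = _ := by ring
  -- If `x = 0` then `κ = 0`, hence `p = 0` and `0 ^ 0 = 1`.
  · have hmin : min 1 (x ^ p) = 1 := by
      refine min_eq_left ?_
      rcases hx0.eq_or_lt with h0 | h0
      · have hκ0 : κ = 0 := by
          have := (mul_eq_zero.1 (h0.symm.trans rfl : ε * (κ : ℝ) = 0)).resolve_left hε.ne'
          exact_mod_cast this
        have : p = 0 := by omega
        rw [this, pow_zero]
      · exact one_le_pow₀ (not_lt.1 fun h1 => hcase ⟨h0, h1⟩)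
    rw [hmin, one_mul]
    have hK : 1 ≤ Real.exp (2 * |(1 - Ω ^ 2) / (4 * Ω)| * M * Real.exp c + c) :=
      Real.one_le_exp (by positivity)
    refine (hdecay α hα₀ hα m n k l h).trans ?_
    refine le_trans (Real.exp_le_exp.2 ?_) (le_mul_of_one_le_left (Real.exp_pos _).le hK)
    have h1 : x ≤ α * ((n + l : ℕ) : ℝ) := by rw [hx]; gcongr
    have := mul_le_mul_of_nonneg_left h1 hc.le
    linarith

/-! ### Integration over the slice. -/

lemma measurable_phi4Integrand (Ω θ μ : ℝ) (m n k l : Index) :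
    Measurable (phi4Integrand Ω θ μ m n k l) := by
  have hγ (r : Fin 2) : Measurable fun α => gammaAlpha Ω Ω α (m r) (n r) (k r) (l r) := by
    unfold gammaAlpha
    split_ifs
    · fun_prop
    · exact measurable_const
  unfold phi4Integrand phi4Alpha
  fun_prop

end MoyalPhi4

theorem theorem2 (Ω : ℝ) (hΩ : 0 < Ω) :
    ∃ c : ℝ, 0 < c ∧ ∀ M : ℝ, 1 < M → ∃ K : ℝ, 0 < K ∧
      ∀ θ μ : ℝ, 0 < θ → ∀ i : ℕ, 1 ≤ i → ∀ m n k l : MoyalPhi4.Index,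
        IntervalIntegrable (MoyalPhi4.phi4Integrand Ω θ μ m n k l) MeasureTheory.volume
          (M ^ (-(i : ℤ))) (M ^ (-(i : ℤ) + 1)) ∧
        |MoyalPhi4.phi4Slice Ω θ μ M i m n k l| ≤
          K * M ^ (-(i : ℤ)) *
            (∏ r : Fin 2,
              min 1 ((M ^ (-(i : ℤ)) * (MoyalPhi4.maxIndex m n k l r : ℝ)) ^
                MoyalPhi4.shift m l r)) *
            Real.exp (-c * ∑ r : Fin 2,
              (M ^ (-(i : ℤ)) * (MoyalPhi4.maxIndex m n k l r : ℝ) +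
                (MoyalPhi4.shift m l r : ℝ))) := by
  obtain ⟨c, hc, hbound⟩ := MoyalPhi4.exists_slice_bound hΩ
  refine ⟨c, hc, fun M hM => ?_⟩
  obtain ⟨K, hK, hKb⟩ := hbound M hM
  -- One `K` per plane; the slice has length `(M - 1) ε ≤ M ε`.
  refine ⟨K ^ 2 * M, by positivity, fun θ μ hθ i hi m n k l => ?_⟩
  have hM0 : 0 < M := by linarith
  set ε := M ^ (-(i : ℤ)) with hε
  have hε0 : 0 < ε := by positivity
  have hε1 : M ^ (-(i : ℤ) + 1) = M * ε := by
    rw [zpow_add₀ hM0.ne', zpow_one, mul_comm]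
  have hMε : M * ε ≤ 1 := by
    rw [← hε1]
    exact zpow_le_one_of_nonpos₀ hM.le (by omega)
  have hεM : ε ≤ M * ε := by nlinarith
  set P : ℝ := (∏ r : Fin 2, min 1 ((ε * (MoyalPhi4.maxIndex m n k l r : ℝ)) ^
    MoyalPhi4.shift m l r)) * Real.exp (-c * ∑ r : Fin 2,
      (ε * (MoyalPhi4.maxIndex m n k l r : ℝ) + (MoyalPhi4.shift m l r : ℝ))) with hP
  have hC := MoyalPhi4.constC_nonneg hΩ
  -- For `i = 1` the upper endpoint is `α = 1`, where the kernel bound is unavailable; it is a null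
  -- set.
  have hpt : ∀ α ∈ Set.Ioc ε (M * ε), α ≠ 1 →
      ‖MoyalPhi4.phi4Integrand Ω θ μ m n k l α‖ ≤ K ^ 2 * P := by
    intro α hα hne
    have hα0 : 0 < α := hε0.trans hα.1
    have hα1 : α < 1 := lt_of_le_of_ne (hα.2.trans hMε) hne
    have hpre0 : 0 ≤ (1 - α) ^ (μ ^ 2 * θ / (8 * Ω)) / (1 + MoyalPhi4.constC Ω * α) ^ 2 :=
      div_nonneg (Real.rpow_nonneg (by linarith) _) (by positivity)
    have hpre : (1 - α) ^ (μ ^ 2 * θ / (8 * Ω)) / (1 + MoyalPhi4.constC Ω * α) ^ 2 ≤ 1 := by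
      refine div_le_one_of_le₀ ?_ (by positivity)
      refine (Real.rpow_le_one (by linarith) (by linarith) (by positivity)).trans ?_
      refine one_le_pow₀ ?_
      have : 0 ≤ MoyalPhi4.constC Ω * α := by positivity
      linarith
    have h0 := hKb ε α hε0 hα.1.le hα.2 hα1 (m 0) (n 0) (k 0) (l 0)
    have h1 := hKb ε α hε0 hα.1.le hα.2 hα1 (m 1) (n 1) (k 1) (l 1)
    rw [Real.norm_eq_abs, MoyalPhi4.phi4Integrand, abs_mul, abs_of_nonneg hpre0]
    refine (mul_le_of_le_one_left (abs_nonneg _) hpre).trans ?_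
    rw [MoyalPhi4.phi4Alpha, Fin.prod_univ_two, abs_mul]
    refine (mul_le_mul h0 h1 (abs_nonneg _) (by positivity)).trans (le_of_eq ?_)
    rw [hP, Fin.prod_univ_two, Fin.sum_univ_two, mul_add (-c) (_ + _) (_ + _), Real.exp_add]
    simp only [MoyalPhi4.maxIndex, MoyalPhi4.shift]
    ring
  have hae : ∀ᵐ α : ℝ, α ≠ 1 := by
    simp [MeasureTheory.ae_iff]
  rw [hε1]
  constructor
  · rw [intervalIntegrable_iff_integrableOn_Ioc_of_le hεM]
    refine MeasureTheory.Measure.integrableOn_of_bounded (M := K ^ 2 * P) (by simp)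
      (MoyalPhi4.measurable_phi4Integrand Ω θ μ m n k l).aestronglyMeasurable ?_
    filter_upwards [MeasureTheory.ae_restrict_mem measurableSet_Ioc,
      MeasureTheory.ae_restrict_of_ae hae] with α h1 h2
    exact hpt α h1 h2
  · have hP0 : 0 ≤ P := by positivity
    have := intervalIntegral.norm_integral_le_of_norm_le_const_ae (a := ε) (b := M * ε)
      (C := K ^ 2 * P) (f := MoyalPhi4.phi4Integrand Ω θ μ m n k l) (by
        filter_upwards [hae] with α h2 h1
        rw [Set.uIoc_of_le hεM] at h1
        exact hpt α h1 h2)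
    rw [MoyalPhi4.phi4Slice, ← hε, hε1, ← Real.norm_eq_abs]
    refine this.trans ?_
    rw [abs_of_nonneg (by linarith), mul_assoc _ _ (Real.exp _), ← hP]
    have hKP : 0 ≤ K ^ 2 * P := by positivity
    nlinarith [mul_nonneg hKP hε0.le]
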